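/- Let $m,n\ge 1$. For a positive semidefinite operator $X$ on a finite-dimensional Hilbert space, its support $\operatorname{supp}(X)$ is the span of its eigenvectors with positive eigenvalue. An operator $E\ge 0$ on a bipartite space $\mathcal A\otimes\mathcal B$ is PPT if its partial transpose $E^{T_B}$ is positive semidefinite, where $T_B$ is the linear map with $(|i\rangle\langle k|\otimes|j\rangle\langle l|)^{T_B}=|i\rangle\langle k|\otimes|l\rangle\langle j|$ in fixed orthonormal product bases. A subspace $S\subseteq \mathcal A\otimes\mathcal B$ is PPT-extendible if there is a nonzero PPT operator $\sigma$ with $\operatorname{supp}(\sigma)\subseteq S^\perp$, and strongly PPT-unextendible if for every integer $k\ge 1$ the subspace $S^{\otimes k}\subseteq \mathcal A^{\otimes k}\otimes\mathcal B^{\otimes k}$ (all copies of $\mathcal A$ versus all copies of $\mathcal B$) is not PPT-extendible. Then the minimum dimension of a strongly PPT-unextendible subspace of $\mathbb C^m\otimes\mathbb C^n$ is $m+n-1$: there is a strongly PPT-unextendible subspace of dimension $m+n-1$, and every strongly PPT-unextendible subspace has dimension at least $m+n-1$. Moreover, the minimum is attained by $S^\perp$, where $$S=\operatorname{span}\{|j\rangle|k+1\rangle-|j+1\rangle|k\rangle:\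 0\le j\le m-2,\ 0\le k\le n-2\};$$ that is, $S^\perp$ is strongly PPT-unextendible and $\dim S^\perp=m+n-1$. -/

import Mathlib

open scoped ComplexOrder

/-! Throughout, `ℂ^ι ⊗ ℂ^κ` is `EuclideanSpace ℂ (ι × κ)` : the coordinate of a vector at `(i, j)`
is its coefficient on `|i⟩|j⟩`, and an operator is its matrix in this product basis. -/

/-- Partial transpose with respect to the second tensor factor:
`(|i⟩⟨k| ⊗ |j⟩⟨l|)^{T_B} = |i⟩⟨k| ⊗ |l⟩⟨j|`. -/
def partialTranspose {ι κ : Type*} (X : Matrix (ι × κ) (ι × κ) ℂ) :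
    Matrix (ι × κ) (ι × κ) ℂ :=
  Matrix.of fun p q => X (p.1, q.2) (q.1, p.2)

/-- A positive semidefinite operator whose partial transpose is positive semidefinite. -/
def IsPPT {ι κ : Type*} (X : Matrix (ι × κ) (ι × κ) ℂ) : Prop :=
  X.PosSemidef ∧ (partialTranspose X).PosSemidef

/-- The support of a positive semidefinite operator: the span of its eigenvectors with positive
eigenvalues. -/
def opSupport {α : Type*} [Fintype α] [DecidableEq α] (X : Matrix α α ℂ) :
    Submodule ℂ (EuclideanSpace ℂ α) :=
  Submodule.span ℂ {v | ∃ μ : ℝ, 0 < μ ∧ Matrix.toEuclideanLin X v = (μ : ℂ) • v}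

/-- There is a nonzero PPT operator supporting on the orthogonal complement of `S`. -/
def IsPPTExtendible {ι κ : Type*} [Fintype ι] [Fintype κ] [DecidableEq ι] [DecidableEq κ]
    (S : Submodule ℂ (EuclideanSpace ℂ (ι × κ))) : Prop :=
  ∃ σ : Matrix (ι × κ) (ι × κ) ℂ, σ ≠ 0 ∧ IsPPT σ ∧ opSupport σ ≤ Sᗮ

/-- The vector `v 0 ⊗ ⋯ ⊗ v (k - 1)`, regarded as a bipartite vector in
`(ℂ^ι)^{⊗ k} ⊗ (ℂ^κ)^{⊗ k}`, where `(ℂ^ι)^{⊗ k}` has the product basis indexed by `Fin k → ι`. -/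
noncomputable def tensorVec {ι κ : Type*} {k : ℕ} (v : Fin k → EuclideanSpace ℂ (ι × κ)) :
    EuclideanSpace ℂ ((Fin k → ι) × (Fin k → κ)) :=
  WithLp.toLp 2 fun p => ∏ i, v i (p.1 i, p.2 i)

/-- The tensor power `S^{⊗ k}` as a bipartite subspace of `(ℂ^ι)^{⊗ k} ⊗ (ℂ^κ)^{⊗ k}`. -/
noncomputable def tensorPow {ι κ : Type*} (S : Submodule ℂ (EuclideanSpace ℂ (ι × κ))) (k : ℕ) :
    Submodule ℂ (EuclideanSpace ℂ ((Fin k → ι) × (Fin k → κ))) :=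
  Submodule.span ℂ {w | ∃ v : Fin k → EuclideanSpace ℂ (ι × κ), (∀ i, v i ∈ S) ∧ w = tensorVec v}

/-- No positive tensor power of `S` is PPT-extendible. -/
def IsStronglyPPTUnextendible {ι κ : Type*} [Fintype ι] [Fintype κ] [DecidableEq ι]
    [DecidableEq κ] (S : Submodule ℂ (EuclideanSpace ℂ (ι × κ))) : Prop :=
  ∀ k : ℕ, 1 ≤ k → ¬ IsPPTExtendible (tensorPow S k)

/-- The span of the vectors `|j⟩|k+1⟩ - |j+1⟩|k⟩` with `0 ≤ j ≤ m - 2` and `0 ≤ k ≤ n - 2`. -/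
noncomputable def antiHankelSubspace (m n : ℕ) :
    Submodule ℂ (EuclideanSpace ℂ (Fin m × Fin n)) :=
  Submodule.span ℂ {v | ∃ (j j' : Fin m) (k k' : Fin n),
    (j' : ℕ) = j + 1 ∧ (k' : ℕ) = k + 1 ∧
      v = EuclideanSpace.single (j, k') (1 : ℂ) - EuclideanSpace.single (j', k) (1 : ℂ)}

/-! Upper bound: the complement of the anti-Hankel span consists of the vectors whose coordinates
depend only on `j + k`, so its tensor powers contain the indicator of every multi-index weight. If a
PPT `σ` kills these, induction on the weight in lexicographic order shows that its diagonal
vanishes: partial transposition moves each off-diagonal term of a relation to a pair of positions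
one of which has smaller weight (`IsPPT.eq_zero_of_forall_sum_weight_eq_zero`). Lower bound: fewer
than `m + n - 1` linear forms have a common nonzero zero on the cone of rank one matrices, by
Krull's height theorem and the Nullstellensatz (`Segre.exists_common_zero`). This gives a product
vector orthogonal to `S`, whose projector is PPT, so `k = 1` already fails. -/

theorem Matrix.PosSemidef.apply_eq_zero_of_diag_right {α : Type*} [Fintype α] [DecidableEq α]
    {M : Matrix α α ℂ} (hM : M.PosSemidef) {p : α} (hp : M p p = 0) (q : α) : M q p = 0 := by
  have h := (hM.dotProduct_mulVec_zero_iff (Pi.single p 1)).1 (by simp [hp])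
  simpa using congrFun h q

theorem Matrix.PosSemidef.apply_eq_zero_of_diag_left {α : Type*} [Fintype α] [DecidableEq α]
    {M : Matrix α α ℂ} (hM : M.PosSemidef) {p : α} (hp : M p p = 0) (q : α) : M p q = 0 := by
  rw [← hM.isHermitian.apply p q, hM.apply_eq_zero_of_diag_right hp, star_zero]

/-- A PPT operator annihilating the sums of the product basis vectors of equal total weight, for
injective weights on the two factors, vanishes. -/
theorem IsPPT.eq_zero_of_forall_sum_weight_eq_zero {ι κ Γ : Type*} [Fintype ι] [Fintype κ]
    [DecidableEq ι] [DecidableEq κ] [AddCommMonoid Γ] [LinearOrder Γ] [IsOrderedCancelAddMonoid Γ]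
    [WellFoundedLT Γ] {a : ι → Γ} {b : κ → Γ} (ha : a.Injective) (hb : b.Injective)
    {σ : Matrix (ι × κ) (ι × κ) ℂ} (hσ : IsPPT σ)
    (h : ∀ p s, ∑ q : ι × κ, (if a q.1 + b q.2 = s then σ p q else 0) = 0) : σ = 0 := by
  have key : ∀ s, ∀ i j, a i + b j = s → σ (i, j) (i, j) = 0 := by
    intro s
    induction s using WellFoundedLT.induction with
    | ind s ih =>
      intro i j hij
      have h0 := h (i, j) s
      rw [Finset.sum_eq_single (i, j)] at h0
      · simpa [hij] using h0
      · rintro ⟨i', j'⟩ - hne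
        split_ifs with hs
        swap
        · rfl
        simp only at hs
        -- The positions `(i, j')` and `(i', j)` have weights summing to `s + s`: either one is
        -- below `s`, or both equal `s` and injectivity gives `(i', j') = (i, j)`. Diagonal entries
        -- are unchanged by partial transposition.
        change partialTranspose σ (i, j') (i', j) = 0
        rcases lt_trichotomy (a i + b j') s with hlt | heq | hgt
        · exact hσ.2.apply_eq_zero_of_diag_left (p := (i, j')) (ih _ hlt i j' rfl) _
        · refine absurd ?_ hne
          rw [ha (add_right_cancel (heq.trans hs.symm)), hb (add_left_cancel (heq.trans hij.symm))]
        · refine hσ.2.apply_eq_zero_of_diag_right (p := (i', j)) (ih (a i' + b j) ?_ i' j rfl) _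
          by_contra! hle
          have h1 := add_lt_add_of_lt_of_le hgt hle
          have h2 : s + s = a i + b j' + (a i' + b j) := by
            nth_rewrite 1 [← hij]
            rw [← hs]
            abel
          exact h1.ne h2
      · simp
  ext p q
  exact hσ.1.apply_eq_zero_of_diag_left (key _ p.1 p.2 rfl) q

/-- A vector orthogonal to the support of a positive semidefinite operator is annihilated. -/
theorem mulVec_eq_zero_of_opSupport_le {α : Type*} [Fintype α] [DecidableEq α]
    {σ : Matrix α α ℂ} (hσ : σ.PosSemidef) {S : Submodule ℂ (EuclideanSpace ℂ α)}
    (hS : opSupport σ ≤ Sᗮ) {w : EuclideanSpace ℂ α} (hw : w ∈ S) : σ.mulVec w = 0 := by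
  rw [← hσ.dotProduct_mulVec_zero_iff]
  have hH := hσ.isHermitian
  have h : Matrix.toEuclideanLin σ w = 0 := by
    -- Against an eigenbasis: null eigenvectors contribute nothing, and the others lie in the
    -- support.
    refine InnerProductSpace.ext_inner_left_basis hH.eigenvectorBasis.toBasis fun i => ?_
    rw [OrthonormalBasis.coe_toBasis, inner_zero_right,
      ← (Matrix.isSymmetric_toEuclideanLin_iff.2 hH)]
    have hv : Matrix.toEuclideanLin σ (hH.eigenvectorBasis i)
        = ((hH.eigenvalues i : ℝ) : ℂ) • hH.eigenvectorBasis i := by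
      apply (WithLp.ofLp_injective 2)
      have := hH.mulVec_eigenvectorBasis i
      ext j
      simpa using congrFun this j
    rw [hv, inner_smul_left]
    rcases (hσ.eigenvalues_nonneg i).eq_or_lt with h0 | h0
    · simp [← h0]
    · have hm : hH.eigenvectorBasis i ∈ Sᗮ := hS (Submodule.subset_span ⟨_, h0, hv⟩)
      rw [Submodule.inner_left_of_mem_orthogonal hw hm, mul_zero]
  have h' : σ.mulVec w = 0 := by simpa using congrArg WithLp.ofLp h
  rw [h', dotProduct_zero]

/-! ### Hankel vectors and the upper bound -/

/-- The bipartite vector whose `(j, k)` coordinate is the `(j + k)`-th entry of a sequence. -/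
noncomputable def hankelVec (m n : ℕ) :
    (Fin (m + n - 1) → ℂ) →ₗ[ℂ] EuclideanSpace ℂ (Fin m × Fin n) where
  toFun h := WithLp.toLp 2 fun p => h ⟨p.1 + p.2, by omega⟩
  map_add' _ _ := rfl
  map_smul' _ _ := rfl

@[simp]
theorem hankelVec_apply {m n : ℕ} (h : Fin (m + n - 1) → ℂ) (p : Fin m × Fin n) :
    hankelVec m n h p = h ⟨p.1 + p.2, by omega⟩ := rfl

theorem mem_antiHankelSubspace_orthogonal {m n : ℕ} {v : EuclideanSpace ℂ (Fin m × Fin n)} :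
    v ∈ (antiHankelSubspace m n)ᗮ ↔ ∀ (j j' : Fin m) (k k' : Fin n),
      (j' : ℕ) = j + 1 → (k' : ℕ) = k + 1 → v (j, k') = v (j', k) := by
  constructor
  · intro hv j j' k k' hj hk
    have hmem : EuclideanSpace.single (j, k') (1 : ℂ) - EuclideanSpace.single (j', k) (1 : ℂ) ∈
        antiHankelSubspace m n := Submodule.subset_span ⟨j, j', k, k', hj, hk, rfl⟩
    have := Submodule.inner_right_of_mem_orthogonal hmem hv
    simpa [inner_sub_left, sub_eq_zero, EuclideanSpace.inner_single_left] using this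
  · intro hv
    rw [antiHankelSubspace, Submodule.mem_orthogonal]
    intro u hu
    induction hu using Submodule.span_induction with
    | mem u hu =>
      obtain ⟨j, j', k, k', hj, hk, rfl⟩ := hu
      simp [inner_sub_left, EuclideanSpace.inner_single_left, hv j j' k k' hj hk]
    | zero => simp
    | add x y _ _ hx hy => rw [inner_add_left, hx, hy, add_zero]
    | smul c x _ hx => rw [inner_smul_left, hx, mul_zero]

theorem range_hankelVec {m n : ℕ} (hm : 1 ≤ m) (hn : 1 ≤ n) :
    LinearMap.range (hankelVec m n) = (antiHankelSubspace m n)ᗮ := by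
  ext v
  rw [mem_antiHankelSubspace_orthogonal]
  constructor
  · rintro ⟨h, rfl⟩ j j' k k' hj hk
    simp only [hankelVec_apply]
    congr 2
    omega
  · intro hv
    have key : ∀ d : ℕ, ∀ (j j' : Fin m) (k k' : Fin n), (j' : ℕ) = j + d → (k' : ℕ) = k + d →
        v (j, k') = v (j', k) := by
      intro d
      induction d with
      | zero =>
        intro j j' k k' hj hk
        rw [Fin.ext (hj.trans (add_zero _)), Fin.ext (hk.trans (add_zero _))]
      | succ d ih =>
        intro j j' k k' hj hk
        rw [ih j ⟨j + d, by omega⟩ ⟨k + 1, by omega⟩ k' rfl (by simp; omega)]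
        exact hv _ _ _ _ (by simp; omega) rfl
    -- Each antidiagonal is read off at its point with the largest row index.
    refine ⟨fun c => v (⟨min (c : ℕ) (m - 1), by omega⟩, ⟨c - min (c : ℕ) (m - 1), by omega⟩), ?_⟩
    ext ⟨j, k⟩
    simp only [hankelVec_apply]
    refine (key (min ((j : ℕ) + k) (m - 1) - j) _ _ _ _ ?_ ?_).symm
    · simp; omega
    · simp; omega

theorem hankelVec_injective {m n : ℕ} (hm : 1 ≤ m) (hn : 1 ≤ n) :
    Function.Injective (hankelVec m n) := by
  intro g h hgh
  ext c
  have := congrArg (fun v : EuclideanSpace ℂ (Fin m × Fin n) =>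
    v (⟨min (c : ℕ) (m - 1), by omega⟩, ⟨c - min (c : ℕ) (m - 1), by omega⟩)) hgh
  simp only [hankelVec_apply] at this
  have hc : (⟨min (c : ℕ) (m - 1) + (c - min (c : ℕ) (m - 1)), by omega⟩ : Fin (m + n - 1)) = c := by
    ext; simp
  rwa [hc] at this

theorem finrank_antiHankelSubspace_orthogonal {m n : ℕ} (hm : 1 ≤ m) (hn : 1 ≤ n) :
    Module.finrank ℂ (antiHankelSubspace m n)ᗮ = m + n - 1 := by
  rw [← range_hankelVec hm hn, LinearMap.finrank_range_of_inj (hankelVec_injective hm hn)]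
  simp

theorem isStronglyPPTUnextendible_antiHankelSubspace_orthogonal (m n : ℕ) :
    IsStronglyPPTUnextendible (antiHankelSubspace m n)ᗮ := by
  rintro k - ⟨σ, hσ0, hσ, hsupp⟩
  refine hσ0 (hσ.eq_zero_of_forall_sum_weight_eq_zero (Γ := Lex (Fin k → ℕ))
    (a := fun J => toLex fun i => (J i : ℕ)) (b := fun K => toLex fun i => (K i : ℕ)) ?_ ?_ ?_)
  · intro J J' h
    ext i
    exact congrFun (toLex.injective h) i
  · intro J J' h
    ext i
    exact congrFun (toLex.injective h) i
  · intro p s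
    -- Each factor is the indicator of one antidiagonal (zero if `s i` is out of range), so the
    -- tensor product is the indicator of total weight `s`.
    let u : Fin k → EuclideanSpace ℂ (Fin m × Fin n) := fun i =>
      WithLp.toLp 2 fun q => if (q.1 + q.2 : ℕ) = ofLex s i then 1 else 0
    have hu : tensorVec u ∈ tensorPow (antiHankelSubspace m n)ᗮ k := by
      refine Submodule.subset_span ⟨u, fun i => ?_, rfl⟩
      rw [mem_antiHankelSubspace_orthogonal]
      intro j j' l l' hj hl
      have : (j : ℕ) + l' = j' + l := by omega
      simp only [u, this]
    have h0 := congrFun (mulVec_eq_zero_of_opSupport_le hσ.1 hsupp hu) p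
    rw [Matrix.mulVec, dotProduct, Pi.zero_apply] at h0
    refine Eq.trans ?_ h0
    refine Finset.sum_congr rfl fun q _ => ?_
    have hq : (tensorVec u).ofLp q =
        if (toLex (fun i => (q.1 i : ℕ)) + toLex fun i => (q.2 i : ℕ)) = s
        then 1 else 0 := by
      simp only [tensorVec, u, Finset.prod_ite_zero, Finset.prod_const_one, Finset.mem_univ,
        true_implies]
      congr 1
      rw [← toLex_add, ← toLex_ofLex s, toLex.injective.eq_iff, funext_iff]
      rfl
    rw [hq, mul_ite, mul_one, mul_zero]
    split_ifs <;> rfl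

/-! ### Height of the irrelevant ideal of the Segre cone -/

namespace Segre

open MvPolynomial

variable (K : Type*) [Field K] (m n : ℕ)

/-- The ideal of the `2 × 2` minors of a generic `m × n` matrix. -/
noncomputable def minorsIdeal : Ideal (MvPolynomial (Fin m × Fin n) K) :=
  Ideal.span {f | ∃ i i' j j', f = X (i, j) * X (i', j') - X (i, j') * X (i', j)}

/-- The parametrisation of the rank one matrices supported on the first `a` rows and the first `b`
columns. -/
noncomputable def param (a b : ℕ) :
    MvPolynomial (Fin m × Fin n) K →ₐ[K] MvPolynomial (Fin m ⊕ Fin n) K :=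
  aeval fun p => if (p.1 : ℕ) < a ∧ (p.2 : ℕ) < b then X (Sum.inl p.1) * X (Sum.inr p.2) else 0

/-- The homomorphism induced by `param` on the coordinate ring of the rank one matrices. -/
noncomputable def paramQuot (a b : ℕ) :
    (MvPolynomial (Fin m × Fin n) K ⧸ minorsIdeal K m n) →+* MvPolynomial (Fin m ⊕ Fin n) K :=
  Ideal.Quotient.lift _ (param K m n a b : _ →+* _) <| by
    intro f hf
    rw [← RingHom.mem_ker]
    refine Ideal.span_le.2 ?_ hf
    rintro _ ⟨i, i', j, j', rfl⟩
    simp only [SetLike.mem_coe, RingHom.mem_ker, RingHom.coe_coe, param, map_sub, map_mul, aeval_X]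
    split_ifs <;> first | ring1 | (exfalso; tauto)

variable {K m n}

theorem paramQuot_mk (a b : ℕ) (f : MvPolynomial (Fin m × Fin n) K) :
    paramQuot K m n a b (Ideal.Quotient.mk _ f) = param K m n a b f := rfl

theorem paramQuot_mk_X (a b : ℕ) (p : Fin m × Fin n) :
    paramQuot K m n a b (Ideal.Quotient.mk _ (X p)) =
      if (p.1 : ℕ) < a ∧ (p.2 : ℕ) < b then X (Sum.inl p.1) * X (Sum.inr p.2) else 0 := by
  rw [paramQuot_mk, param, aeval_X]

/-- The smaller parametrisation is the larger one followed by setting the excess variables to zero.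
-/
theorem ker_paramQuot_le {a b a' b' : ℕ} (ha : a ≤ a') (hb : b ≤ b') :
    RingHom.ker (paramQuot K m n a' b') ≤ RingHom.ker (paramQuot K m n a b) := by
  let r : MvPolynomial (Fin m ⊕ Fin n) K →ₐ[K] MvPolynomial (Fin m ⊕ Fin n) K :=
    aeval (Sum.elim (fun i => if (i : ℕ) < a then X (Sum.inl i) else 0)
      (fun j => if (j : ℕ) < b then X (Sum.inr j) else 0))
  have hr : (r.comp (param K m n a' b')) = param K m n a b := by
    ext1 p
    simp only [param, r, AlgHom.comp_apply, aeval_X]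
    split_ifs with h1 h2 h2
    · simp [h2]
    · rw [map_mul, aeval_X, aeval_X]
      simp only [Sum.elim_inl, Sum.elim_inr]
      split_ifs <;> first | rfl | simp only [mul_zero] | (exfalso; exact h2 ⟨by assumption, by assumption⟩)
    · exact absurd ⟨h2.1.trans_le ha, h2.2.trans_le hb⟩ h1
    · simp
  intro f hf
  obtain ⟨f, rfl⟩ := Ideal.Quotient.mk_surjective f
  rw [RingHom.mem_ker, paramQuot_mk] at hf ⊢
  rw [← hr, AlgHom.comp_apply, hf, map_zero]

theorem ker_paramQuot_lt {a b a' b' : ℕ} (ha : a ≤ a') (hb : b ≤ b') (p : Fin m × Fin n)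
    (hp : (p.1 : ℕ) < a' ∧ (p.2 : ℕ) < b') (hp' : ¬ ((p.1 : ℕ) < a ∧ (p.2 : ℕ) < b)) :
    RingHom.ker (paramQuot K m n a' b') < RingHom.ker (paramQuot K m n a b) := by
  refine lt_of_le_of_ne (ker_paramQuot_le ha hb) fun h => ?_
  have h1 : Ideal.Quotient.mk _ (X p) ∈ RingHom.ker (paramQuot K m n a b) := by
    rw [RingHom.mem_ker, paramQuot_mk_X, if_neg hp']
  rw [← h, RingHom.mem_ker, paramQuot_mk_X, if_pos hp] at h1
  exact mul_ne_zero (X_ne_zero _) (X_ne_zero _) h1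

theorem add_one_le_height_ker_paramQuot {a b a' b' s : ℕ} (ha : a ≤ a') (hb : b ≤ b')
    (p : Fin m × Fin n) (hp : (p.1 : ℕ) < a' ∧ (p.2 : ℕ) < b')
    (hp' : ¬ ((p.1 : ℕ) < a ∧ (p.2 : ℕ) < b))
    (hs : (s : ℕ∞) ≤ (RingHom.ker (paramQuot K m n a' b')).height) :
    ((s + 1 : ℕ) : ℕ∞) ≤ (RingHom.ker (paramQuot K m n a b)).height := by
  have h1 : (RingHom.ker (paramQuot K m n a b)).IsPrime := RingHom.ker_isPrime _
  have h2 : (RingHom.ker (paramQuot K m n a' b')).IsPrime := RingHom.ker_isPrime _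
  have := Ideal.height_strict_mono_of_isPrime_of_isPrime (ker_paramQuot_lt (K := K) ha hb p hp hp')
  push_cast
  exact Order.add_one_le_of_lt (hs.trans_lt this)

/-- Adding one row or column at a time gives a strictly descending chain of primes; the last step,
from `(1, 1)` to `(0, 0)`, is left to `le_height_irrelevant`. -/
theorem le_height_ker_paramQuot (s : ℕ) : ∀ a b : ℕ, 1 ≤ a → a ≤ m → 1 ≤ b → b ≤ n →
    (m - a) + (n - b) = s → (s : ℕ∞) ≤ (RingHom.ker (paramQuot K m n a b)).height := by
  induction s with
  | zero => intros; simp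
  | succ s ih =>
    intro a b ha ham hb hbn hs
    rcases ham.lt_or_eq with h | h
    · exact add_one_le_height_ker_paramQuot (Nat.le_succ a) le_rfl (⟨a, h⟩, ⟨0, by omega⟩)
        (by simp; omega) (by simp) (ih (a + 1) b (by omega) (by omega) hb hbn (by omega))
    · exact add_one_le_height_ker_paramQuot le_rfl (Nat.le_succ b) (⟨0, by omega⟩, ⟨b, by omega⟩)
        (by simp; omega) (by simp) (ih a (b + 1) ha ham (by omega) (by omega) (by omega))

theorem le_height_irrelevant (hm : 1 ≤ m) (hn : 1 ≤ n) :
    ((m + n - 1 : ℕ) : ℕ∞) ≤ (RingHom.ker (paramQuot K m n 0 0)).height := by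
  have h := add_one_le_height_ker_paramQuot (K := K) (Nat.zero_le 1) (Nat.zero_le 1)
    (⟨0, hm⟩, ⟨0, hn⟩) (by simp) (by simp)
    (le_height_ker_paramQuot (K := K) (m := m) (n := n) _ 1 1 le_rfl hm le_rfl hn rfl)
  rwa [show (m - 1) + (n - 1) + 1 = m + n - 1 by omega] at h

theorem aeval_zero_eq_zero {f : MvPolynomial (Fin m × Fin n) K}
    (hf : Ideal.Quotient.mk _ f ∈ RingHom.ker (paramQuot K m n 0 0)) :
    aeval (0 : Fin m × Fin n → K) f = 0 := by
  rw [RingHom.mem_ker, paramQuot_mk] at hf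
  have : (aeval (0 : Fin m ⊕ Fin n → K)).comp (param K m n 0 0) =
      aeval (0 : Fin m × Fin n → K) := by
    ext p
    simp [param]
  rw [← this, AlgHom.comp_apply, hf, map_zero]

variable [IsAlgClosed K]

/-- Fewer than `m + n - 1` bilinear forms on `K^m × K^n` over an algebraically closed field have a
common zero `(x, y)` with `x ≠ 0` and `y ≠ 0`. -/
theorem exists_common_zero (hm : 1 ≤ m) (hn : 1 ≤ n) {d : ℕ} (hd : d < m + n - 1)
    (c : Fin d → Fin m × Fin n → K) :
    ∃ (x : Fin m → K) (y : Fin n → K), x ≠ 0 ∧ y ≠ 0 ∧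
      ∀ l, ∑ p, c l p * (x p.1 * y p.2) = 0 := by
  by_contra! H
  let F : Fin d → MvPolynomial (Fin m × Fin n) K := fun l => ∑ p, C (c l p) * X p
  let s : Set (MvPolynomial (Fin m × Fin n) K ⧸ minorsIdeal K m n) :=
    Set.range fun l => Ideal.Quotient.mk _ (F l)
  have hmin : RingHom.ker (paramQuot K m n 0 0) ∈ (Ideal.span s).minimalPrimes := by
    refine ⟨⟨RingHom.ker_isPrime _, ?_⟩, ?_⟩
    · rw [Ideal.span_le]
      rintro _ ⟨l, rfl⟩
      simp [F, paramQuot_mk, param]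
    · rintro q ⟨hq, hsq⟩ - f hf
      obtain ⟨f, rfl⟩ := Ideal.Quotient.mk_surjective f
      have hq' : (q.comap (Ideal.Quotient.mk (minorsIdeal K m n))).IsPrime := hq.comap _
      change f ∈ q.comap (Ideal.Quotient.mk (minorsIdeal K m n))
      -- By the Nullstellensatz, minimality of the irrelevant ideal over the forms reduces to the
      -- origin being their only zero on the cone.
      rw [← hq'.radical, ← vanishingIdeal_zeroLocus_eq_radical (K := K), mem_vanishingIdeal_iff]
      intro z hz
      suffices z = 0 by
        rw [this]
        exact aeval_zero_eq_zero hf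
      have hminor : ∀ i i' j j', z (i, j) * z (i', j') = z (i, j') * z (i', j) := by
        intro i i' j j'
        have := hz (X (i, j) * X (i', j') - X (i, j') * X (i', j)) (by
          refine Ideal.mem_comap.2 ?_
          rw [Ideal.Quotient.eq_zero_iff_mem.2]
          · exact q.zero_mem
          · exact Ideal.subset_span ⟨i, i', j, j', rfl⟩)
        simpa [sub_eq_zero] using this
      have hF : ∀ l, ∑ p, c l p * z p = 0 := by
        intro l
        have := hz (F l) (hsq (Ideal.subset_span ⟨l, rfl⟩))
        simpa [F] using this
      by_contra hz0
      obtain ⟨⟨i₀, j₀⟩, h0⟩ := Function.ne_iff.1 hz0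
      simp only [Pi.zero_apply] at h0
      -- For `z` of rank one, column `j₀` times row `i₀` is `z (i₀, j₀)` times `z`.
      obtain ⟨l, hl⟩ := H (fun i => z (i, j₀)) (fun j => z (i₀, j))
        (Function.ne_iff.2 ⟨i₀, h0⟩) (Function.ne_iff.2 ⟨j₀, h0⟩)
      apply hl
      rw [← zero_mul (z (i₀, j₀)), ← hF l, Finset.sum_mul]
      refine Finset.sum_congr rfl fun p _ => ?_
      rw [hminor p.1 i₀ j₀ p.2]
      ring
  have h1 := (le_height_irrelevant hm hn).trans
    (Ideal.height_le_card_of_mem_minimalPrimes_span (Set.finite_range _) hmin)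
  have h2 : s.ncard ≤ d := by
    rw [← Nat.card_coe_set_eq]
    simpa using Finite.card_range_le fun l => Ideal.Quotient.mk (minorsIdeal K m n) (F l)
  have h3 : m + n - 1 ≤ s.ncard := by exact_mod_cast h1
  omega

end Segre

/-! ### Product vectors and the lower bound -/

/-- A subspace of `ℂ^m ⊗ ℂ^n` of dimension less than `m + n - 1` has a nonzero product vector in its
orthogonal complement. -/
theorem exists_product_mem_orthogonal {m n : ℕ} (hm : 1 ≤ m) (hn : 1 ≤ n)
    (S : Submodule ℂ (EuclideanSpace ℂ (Fin m × Fin n)))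
    (hS : Module.finrank ℂ S < m + n - 1) :
    ∃ (x : Fin m → ℂ) (y : Fin n → ℂ), x ≠ 0 ∧ y ≠ 0 ∧
      (WithLp.toLp 2 fun p : Fin m × Fin n => x p.1 * y p.2) ∈ Sᗮ := by
  let b := Module.finBasis ℂ S
  obtain ⟨x, y, hx, hy, h⟩ :=
    Segre.exists_common_zero hm hn hS fun l p => star ((b l : EuclideanSpace ℂ _) p)
  refine ⟨x, y, hx, hy, ?_⟩
  set z : EuclideanSpace ℂ (Fin m × Fin n) := WithLp.toLp 2 fun p => x p.1 * y p.2 with hz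
  have h0 : (innerSL ℂ z).toLinearMap ∘ₗ S.subtype = 0 := by
    refine b.ext fun l => ?_
    have : inner ℂ ((b l : S) : EuclideanSpace ℂ (Fin m × Fin n)) z = 0 := by
      rw [← h l, PiLp.inner_apply]
      refine Finset.sum_congr rfl fun p _ => ?_
      simp [hz, mul_comm]
    simpa using inner_eq_zero_symm.1 this
  rw [Submodule.mem_orthogonal']
  intro v hv
  exact LinearMap.congr_fun h0 ⟨v, hv⟩

/-- Partial transposition replaces `y` by its conjugate, giving another rank one positive operator.
-/
theorem isPPT_vecMulVec_product {ι κ : Type*} [Fintype ι] [Fintype κ] (x : ι → ℂ) (y : κ → ℂ) :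
    IsPPT (Matrix.vecMulVec (fun p : ι × κ => x p.1 * y p.2)
      (star fun p : ι × κ => x p.1 * y p.2)) := by
  refine ⟨Matrix.posSemidef_vecMulVec_self_star _, ?_⟩
  convert Matrix.posSemidef_vecMulVec_self_star (fun p : ι × κ => x p.1 * star (y p.2)) using 1
  ext p q
  simp only [partialTranspose, Matrix.of_apply, Matrix.vecMulVec_apply, Pi.star_apply, star_mul,
    star_star]
  ring

theorem isPPTExtendible_of_product_mem_orthogonal {ι κ : Type*} [Fintype ι] [Fintype κ]
    [DecidableEq ι] [DecidableEq κ] {S : Submodule ℂ (EuclideanSpace ℂ (ι × κ))}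
    {x : ι → ℂ} {y : κ → ℂ} (hx : x ≠ 0) (hy : y ≠ 0)
    (h : (WithLp.toLp 2 fun p : ι × κ => x p.1 * y p.2) ∈ Sᗮ) : IsPPTExtendible S := by
  refine ⟨_, ?_, isPPT_vecMulVec_product x y, ?_⟩
  · obtain ⟨i, hi⟩ := Function.ne_iff.1 hx
    obtain ⟨j, hj⟩ := Function.ne_iff.1 hy
    intro h0
    have := congrFun (congrFun h0 (i, j)) (i, j)
    simp only [Matrix.vecMulVec_apply, Pi.star_apply, Matrix.zero_apply, mul_eq_zero,
      star_eq_zero] at this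
    simp_all
  · refine Submodule.span_le.2 ?_
    rintro v ⟨μ, hμ, hv⟩
    have hμ' : (μ : ℂ) ≠ 0 := by exact_mod_cast hμ.ne'
    -- An eigenvector with nonzero eigenvalue lies in the range, which is spanned by the product
    -- vector.
    rw [SetLike.mem_coe, ← inv_smul_smul₀ hμ' v, ← hv]
    refine Submodule.smul_mem _ _ ?_
    convert Submodule.smul_mem _
      ((star fun p : ι × κ => x p.1 * y p.2) ⬝ᵥ (v : ι × κ → ℂ)) h using 1
    ext p
    simp [Matrix.toLpLin_apply, Matrix.vecMulVec_mulVec, mul_comm]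

theorem IsStronglyPPTUnextendible.le_finrank {m n : ℕ} (hm : 1 ≤ m) (hn : 1 ≤ n)
    {S : Submodule ℂ (EuclideanSpace ℂ (Fin m × Fin n))} (hS : IsStronglyPPTUnextendible S) :
    m + n - 1 ≤ Module.finrank ℂ S := by
  by_contra! hlt
  obtain ⟨x, y, hx, hy, hxy⟩ := exists_product_mem_orthogonal hm hn S hlt
  refine hS 1 le_rfl (isPPTExtendible_of_product_mem_orthogonal
    (x := fun J => x (J 0)) (y := fun L => y (L 0)) ?_ ?_ ?_)
  · obtain ⟨i, hi⟩ := Function.ne_iff.1 hx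
    exact Function.ne_iff.2 ⟨fun _ => i, hi⟩
  · obtain ⟨j, hj⟩ := Function.ne_iff.1 hy
    exact Function.ne_iff.2 ⟨fun _ => j, hj⟩
  · rw [Submodule.mem_orthogonal]
    intro u hu
    induction hu using Submodule.span_induction with
    | mem u hu =>
      obtain ⟨v, hv, rfl⟩ := hu
      rw [← Submodule.inner_right_of_mem_orthogonal (hv 0) hxy, PiLp.inner_apply, PiLp.inner_apply]
      refine Fintype.sum_equiv
        ((Equiv.funUnique (Fin 1) (Fin m)).prodCongr (Equiv.funUnique (Fin 1) (Fin n))) _ _ ?_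
      intro p
      simp [tensorVec, Prod.map]
    | zero => simp
    | add a b _ _ ha hb => rw [inner_add_left, ha, hb, add_zero]
    | smul c a _ ha => rw [inner_smul_left, ha, mul_zero]

theorem mainTheorem5 (m n : ℕ) (hm : 1 ≤ m) (hn : 1 ≤ n) :
    IsLeast {d : ℕ | ∃ S : Submodule ℂ (EuclideanSpace ℂ (Fin m × Fin n)),
        IsStronglyPPTUnextendible S ∧ Module.finrank ℂ S = d} (m + n - 1) ∧
      IsStronglyPPTUnextendible (antiHankelSubspace m n)ᗮ ∧
      Module.finrank ℂ (antiHankelSubspace m n)ᗮ = m + n - 1 := by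
  have h := isStronglyPPTUnextendible_antiHankelSubspace_orthogonal m n
  have hd := finrank_antiHankelSubspace_orthogonal hm hn
  refine ⟨⟨⟨_, h, hd⟩, ?_⟩, h, hd⟩
  rintro d ⟨S, hS, rfl⟩
  exact hS.le_finrank hm hn
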